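/- Let $n\ge 2$, let $U\subset\mathbb{C}^n$ be an open neighbourhood of $0$, and let $\omega$ be a holomorphic 1-form on $U$ with $\omega\wedge d\omega=0$ whose zero set $\mathrm{Sing}(\mathcal F)$ has codimension at least two; it defines a codimension one holomorphic foliation $\mathcal F$. Let $f$ be holomorphic on $U$ with reduced (squarefree) germ at $0$, and suppose that $V=\{f=0\}$ is invariant by $\mathcal F$, i.e. the leaf through each point of $V$ outside $\mathrm{Sing}(\mathcal F)$ is contained in $V$. Let $g,h$ be holomorphic functions and $\eta$ a holomorphic 1-form on $U$ with $$g\,\omega=h\,df+f\,\eta,$$ where at $0$ the germs $h,f$ have no common factor and the germs $g,f$ have no common factor. Let $\mathrm{Sing}_2(\mathcal F)$ be the union of the codimension two components of $\mathrm{Sing}(\mathcal F)$, put $\mathrm{Sing}(V)=\{f=0,\ df=0\}$ and $\mathrm{Sing}_2(\mathcal F,V)=\mathrm{Sing}(V)\cup(\mathrm{Sing}_2(\mathcal F)\cap V)$, and let $Z$ be a set whose germ at $0$ is an irreducible component, of codimension two, of the germ of $\mathrm{Sing}_2(\mathcal F,V)$ at $0$. Let $p\in Z$ be a generic point and $B\subset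 U$ a ball centred at $p$, in the sense that $Z$ is a codimension two submanifold near $p$, $\mathrm{Sing}_2(\mathcal F,V)\cap B=Z\cap B$ and $\mathrm{Sing}(\mathcal F)\cap B\subset Z$. Let $\Sigma_p\subset V\cap B$ be a one-dimensional section transverse to $Z$ at $p$, with $\Sigma_p\cap Z=\{p\}$: a union of finitely many (at least one) closed holomorphically parametrised discs, embedded and immersed except possibly at their common centre $p$, meeting only at $p$, and contained near $p$ in a two-dimensional complex submanifold transverse to $Z$. Let $\Gamma$ be the positive generator of $H_1(\Sigma_p\setminus\{p\},\mathbb{Z})$ (if $\Sigma_p$ has several branches, the sum of the positive generators of the branches), represented on each branch by a closed $C^1$ curve along which $g$ and $h$ do not vanish. The variational index computed with these choices is $$\mathrm{Var}(\mathcal F,V,Z)=\frac1{2\pi i}\int_\Gamma\beta ,$$ where $\beta$ is a smooth $(1,0)$-form on $B\setminus\mathrm{Sing}_2(\mathcal F,V)$ with $d\omega=\beta\wedge\omega$. Then such a form $\beta$ exists, the index does not depend on the choice of $\beta$, the form $\frac gh\,d\!\left(\frac hg\right)-\frac\eta h$ is integrable along $\Gamma$, and $$\mathrm{Var}(\mathcal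 F,V,Z)=\frac1{2\pi i}\int_\Gamma\left(\frac gh\,d\!\left(\frac hg\right)-\frac{\eta}{h}\right).$$ -/

import Mathlib

open Set Filter Topology
open scoped unitInterval

noncomputable section

namespace FoliationGerm

/-- Complex affine `n`-space with its Hermitian norm. -/
abbrev Cn (n : ℕ) : Type := EuclideanSpace ℂ (Fin n)

/-- A (1,0)-form: at each point a `ℂ`-linear functional. -/
abbrev OneForm (n : ℕ) : Type := Cn n → (Cn n →L[ℂ] ℂ)

/-- The ring `𝒪₀` of germs at `0 ∈ ℂⁿ` of holomorphic functions. -/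
def holGerms (n : ℕ) : Subring ((𝓝 (0 : Cn n)).Germ ℂ) where
  carrier := {a | ∃ F : Cn n → ℂ, AnalyticAt ℂ F 0 ∧ a = (F : (𝓝 (0 : Cn n)).Germ ℂ)}
  mul_mem' := by
    rintro _ _ ⟨F, hF, rfl⟩ ⟨G, hG, rfl⟩
    exact ⟨F * G, hF.mul hG, rfl⟩
  one_mem' := ⟨fun _ => 1, analyticAt_const, rfl⟩
  add_mem' := by
    rintro _ _ ⟨F, hF, rfl⟩ ⟨G, hG, rfl⟩
    exact ⟨F + G, hF.add hG, rfl⟩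
  zero_mem' := ⟨fun _ => 0, analyticAt_const, rfl⟩
  neg_mem' := by
    rintro _ ⟨F, hF, rfl⟩
    exact ⟨-F, hF.neg, rfl⟩

/-- The germ at `0` of a function that is holomorphic near `0`. -/
def germOf {n : ℕ} (F : Cn n → ℂ) (hF : AnalyticAt ℂ F 0) : holGerms n :=
  ⟨(F : (𝓝 (0 : Cn n)).Germ ℂ), F, hF, rfl⟩

/-- The map `F` cuts out `A` as a complex submanifold of codimension `k` near `x`. -/
def CutsOut {n k : ℕ} (F : Cn n → (Fin k → ℂ)) (A : Set (Cn n)) (x : Cn n) : Prop :=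
  AnalyticAt ℂ F x ∧ Function.Surjective (fderiv ℂ F x) ∧ ∀ᶠ y in 𝓝 x, (y ∈ A ↔ F y = 0)

/-- `x ∈ A`, and `A` is near `x` a complex submanifold of codimension `k`. -/
def IsRegularPoint {n : ℕ} (k : ℕ) (A : Set (Cn n)) (x : Cn n) : Prop :=
  x ∈ A ∧ ∃ F : Cn n → (Fin k → ℂ), CutsOut F A x

/-- The germ at `0` of the set `A` is a complex analytic germ. -/
def IsAnalyticGerm {n : ℕ} (A : Set (Cn n)) : Prop :=
  ∃ (m : ℕ) (F : Fin m → Cn n → ℂ), (∀ i, AnalyticAt ℂ (F i) 0) ∧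
    ∀ᶠ x in 𝓝 0, (x ∈ A ↔ ∀ i, F i x = 0)

/-- The germ at `0` of `A` is a (nonempty) irreducible complex analytic germ. -/
def IsIrreducibleGerm {n : ℕ} (A : Set (Cn n)) : Prop :=
  IsAnalyticGerm A ∧ 0 ∈ A ∧
    ∀ A₁ A₂ : Set (Cn n), IsAnalyticGerm A₁ → IsAnalyticGerm A₂ →
      A =ᶠ[𝓝 0] (A₁ ∪ A₂ : Set (Cn n)) → A =ᶠ[𝓝 0] A₁ ∨ A =ᶠ[𝓝 0] A₂

/-- The germ at `0` of `Z` is an irreducible component of the germ at `0` of `S`. -/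
def IsIrreducibleComponent {n : ℕ} (Z S : Set (Cn n)) : Prop :=
  IsIrreducibleGerm Z ∧ Z ≤ᶠ[𝓝 0] S ∧
    ∀ Z' : Set (Cn n), IsIrreducibleGerm Z' → Z ≤ᶠ[𝓝 0] Z' → Z' ≤ᶠ[𝓝 0] S → Z' =ᶠ[𝓝 0] Z

/-- The irreducible germ at `0` of `Z` has codimension `k`: arbitrarily close to `0` there are
points at which `Z` is a submanifold of codimension `k`. -/
def HasCodim {n : ℕ} (k : ℕ) (Z : Set (Cn n)) : Prop :=
  ∃ᶠ x in 𝓝 0, IsRegularPoint k Z x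

/-- The exterior derivative of a holomorphic 1-form, `dω(u, v) = D_u ω (v) - D_v ω (u)`. -/
def dForm {n : ℕ} (ω : OneForm n) (x u v : Cn n) : ℂ :=
  fderiv ℂ ω x u v - fderiv ℂ ω x v u

/-- The wedge product of two 1-forms at a point. -/
def wedge {n : ℕ} (α β : Cn n →L[ℂ] ℂ) (u v : Cn n) : ℂ :=
  α u * β v - α v * β u

/-- The singular set of the foliation `ω = 0` on `U`. -/
def singSet {n : ℕ} (U : Set (Cn n)) (ω : OneForm n) : Set (Cn n) :=
  {x ∈ U | ω x = 0}

/-- `ω` defines a codimension one singular holomorphic foliation on `U`: it is holomorphic,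
integrable (`ω ∧ dω = 0`), and its zero set has codimension at least two. -/
structure IsFoliation {n : ℕ} (U : Set (Cn n)) (ω : OneForm n) : Prop where
  holomorphic : AnalyticOnNhd ℂ ω U
  integrable : ∀ x ∈ U, ∀ u v w : Cn n,
    ω x u * dForm ω x v w - ω x v * dForm ω x u w + ω x w * dForm ω x u v = 0
  codim : ∀ x, ¬ IsRegularPoint 0 (singSet U ω) x ∧ ¬ IsRegularPoint 1 (singSet U ω) x

/-- The leaf through `x` of the foliation `ω = 0` on `U`, where `ω x ≠ 0`: the points that can be
joined to `x` by a `C¹` curve tangent to `ker ω` in the regular part of the foliation. -/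
def leaf {n : ℕ} (U : Set (Cn n)) (ω : OneForm n) (x : Cn n) : Set (Cn n) :=
  {y | ∃ γ : ℝ → Cn n, ContDiffOn ℝ 1 γ (Icc 0 1) ∧ γ 0 = x ∧ γ 1 = y ∧
    ∀ t ∈ Icc (0 : ℝ) 1, γ t ∈ U ∧ ω (γ t) ≠ 0 ∧ ω (γ t) (derivWithin γ (Icc 0 1) t) = 0}

/-- `V = {f = 0}` in `U`. -/
def hyp {n : ℕ} (U : Set (Cn n)) (f : Cn n → ℂ) : Set (Cn n) :=
  {x ∈ U | f x = 0}

/-- The singular set of `V = {f = 0}`, where `f` is a reduced equation. -/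
def hypSing {n : ℕ} (U : Set (Cn n)) (f : Cn n → ℂ) : Set (Cn n) :=
  {x ∈ U | f x = 0 ∧ fderiv ℂ f x = 0}

/-- `V = {f = 0}` is invariant: the leaf through a point of `V` in the regular part of the
foliation is contained in `V`. -/
def IsInvariant {n : ℕ} (U : Set (Cn n)) (ω : OneForm n) (f : Cn n → ℂ) : Prop :=
  ∀ x ∈ hyp U f, ω x ≠ 0 → leaf U ω x ⊆ hyp U f

/-- `Sing₂(𝓕)`, the union of the irreducible components of codimension two of the singular set,
that is, the closure in `U` of the points where that set is a submanifold of codimension two. -/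
def sing₂ {n : ℕ} (U : Set (Cn n)) (ω : OneForm n) : Set (Cn n) :=
  U ∩ closure {x | IsRegularPoint 2 (singSet U ω) x}

/-- `Sing₂(𝓕, V) = Sing(V) ∪ (Sing₂(𝓕) ∩ V)`. -/
def sing₂V {n : ℕ} (U : Set (Cn n)) (ω : OneForm n) (f : Cn n → ℂ) : Set (Cn n) :=
  hypSing U f ∪ (sing₂ U ω ∩ hyp U f)

/-- Saito's decomposition `g ω = h df + f η` on `U`, with holomorphic `g`, `h`, `η`, where the
germs at `0` of `h` and `f`, and those of `g` and `f`, have no common factor. -/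
structure IsSaitoDecomposition {n : ℕ} (U : Set (Cn n)) (ω : OneForm n) (f g h : Cn n → ℂ)
    (η : OneForm n) : Prop where
  g_hol : AnalyticOnNhd ℂ g U
  h_hol : AnalyticOnNhd ℂ h U
  η_hol : AnalyticOnNhd ℂ η U
  eq : ∀ x ∈ U, g x • ω x = h x • fderiv ℂ f x + f x • η x
  coprime_h : ∃ (hh : AnalyticAt ℂ h 0) (hf : AnalyticAt ℂ f 0),
    IsRelPrime (germOf h hh) (germOf f hf)
  coprime_g : ∃ (hg : AnalyticAt ℂ g 0) (hf : AnalyticAt ℂ f 0),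
    IsRelPrime (germOf g hg) (germOf f hf)

/-- `p` is a generic point of the component `Z` of `Sing₂(𝓕, V)` and `B = ball p r` is a ball
around it as in the definition of the variational index: `Z` is smooth of codimension two at `p`,
and `B` meets no other part of `Sing₂(𝓕, V)` and no other singular point of the foliation. -/
structure IsGenericBall {n : ℕ} (U : Set (Cn n)) (ω : OneForm n) (f : Cn n → ℂ)
    (Z : Set (Cn n)) (p : Cn n) (r : ℝ) : Prop where
  r_pos : 0 < r
  subset : Metric.ball p r ⊆ U
  smooth : IsRegularPoint 2 Z p
  sing₂V_eq : sing₂V U ω f ∩ Metric.ball p r = Z ∩ Metric.ball p r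
  sing_subset : singSet U ω ∩ Metric.ball p r ⊆ Z

/-- The curves `φ i` through `p = φ i 0` lie, near `p`, in a two-dimensional complex submanifold
`{G = 0}` that is transverse to `Z` at `p`. -/
def IsTransverse {n m : ℕ} (Z : Set (Cn n)) (p : Cn n) (φ : Fin m → ℂ → Cn n) : Prop :=
  ∃ (F : Cn n → (Fin 2 → ℂ)) (G : Cn n → (Fin (n - 2) → ℂ)),
    CutsOut F Z p ∧
    AnalyticAt ℂ G p ∧ Function.Surjective (fderiv ℂ G p) ∧
    (∀ u, fderiv ℂ F p u = 0 → fderiv ℂ G p u = 0 → u = 0) ∧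
    ∀ i, ∀ᶠ s in 𝓝 (0 : ℂ), G (φ i s) = 0

/-- A small one-dimensional section `Σ_p ⊆ V` transverse to `Z` at `p`, inside the ball of radius
`r` around `p`. It may be singular at `p`: it is the union of `m ≥ 1` local branches, and the `i`-th
one is the homeomorphic image of the closed unit disc under a holomorphic map `φ i` that is
immersive off `0`. Different branches meet only in `p`. -/
structure TransverseSection {n : ℕ} (U : Set (Cn n)) (f : Cn n → ℂ) (Z : Set (Cn n))
    (p : Cn n) (r : ℝ) where
  m : ℕ
  m_pos : 0 < m
  φ : Fin m → ℂ → Cn n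
  analytic : ∀ i, AnalyticOnNhd ℂ (φ i) (Metric.closedBall 0 1)
  injOn : ∀ i, InjOn (φ i) (Metric.closedBall 0 1)
  immersive : ∀ i, ∀ s ∈ Metric.closedBall (0 : ℂ) 1, s ≠ 0 → deriv (φ i) s ≠ 0
  center : ∀ i, φ i 0 = p
  mem : ∀ i, ∀ s ∈ Metric.closedBall (0 : ℂ) 1, φ i s ∈ hyp U f ∩ Metric.ball p r
  notMem : ∀ i, ∀ s ∈ Metric.closedBall (0 : ℂ) 1, s ≠ 0 → φ i s ∉ Z
  disjoint : ∀ i j, i ≠ j → ∀ s ∈ Metric.closedBall (0 : ℂ) 1,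
    ∀ t ∈ Metric.closedBall (0 : ℂ) 1, φ i s = φ j t → s = 0 ∧ t = 0
  transverse : IsTransverse Z p φ

/-- A positively oriented generator of `H₁(Σ_p \ {p}, ℤ)`: on each branch of `Σ_p` (a disc) a closed
`C¹` curve, which in the coordinate `s` of the punctured disc is a loop `δ i` with winding number
one around `0`. If `Σ_p` has several branches, this is the sum of these curves. -/
structure PositiveGenerator {n : ℕ} {U : Set (Cn n)} {f : Cn n → ℂ} {Z : Set (Cn n)}
    {p : Cn n} {r : ℝ} (S : TransverseSection U f Z p r) where
  z : Fin S.m → ℂ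
  δ : ∀ i, Path (z i) (z i)
  smooth : ∀ i, ContDiffOn ℝ 1 (δ i).extend I
  mem : ∀ i t, δ i t ∈ Metric.closedBall (0 : ℂ) 1
  ne_zero : ∀ i t, δ i t ≠ 0
  winding : ∀ i, curveIntegral (fun s : ℂ => s⁻¹ • (1 : ℂ →L[ℂ] ℂ)) (δ i)
    = 2 * Real.pi * Complex.I

namespace PositiveGenerator

variable {n : ℕ} {U : Set (Cn n)} {f : Cn n → ℂ} {Z : Set (Cn n)} {p : Cn n} {r : ℝ}
  {S : TransverseSection U f Z p r}

/-- The closed curve in `Σ_p \ {p}` on the `i`-th branch. -/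
def curve (Γ : PositiveGenerator S) (i : Fin S.m) :
    Path (S.φ i (Γ.z i)) (S.φ i (Γ.z i)) :=
  (Γ.δ i).map' (f := S.φ i) <| (S.analytic i).continuousOn.mono <| by
    rintro _ ⟨t, rfl⟩
    exact Γ.mem i t

/-- The integral over `Γ` of a (1,0)-form. -/
def integral (Γ : PositiveGenerator S) (α : OneForm n) : ℂ :=
  ∑ i, curveIntegral α (Γ.curve i)

end PositiveGenerator

/-- A smooth (1,0)-form `β` on `B* = B \ Sing₂(𝓕, V)` with `dω = β ∧ ω`, where `B = ball p r`. -/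
structure IsGodbillonForm {n : ℕ} (U : Set (Cn n)) (ω : OneForm n) (f : Cn n → ℂ)
    (p : Cn n) (r : ℝ) (β : OneForm n) : Prop where
  smooth : ContDiffOn ℝ ((⊤ : ℕ∞) : WithTop ℕ∞) β (Metric.ball p r \ sing₂V U ω f)
  eq : ∀ x ∈ Metric.ball p r \ sing₂V U ω f, ∀ u v : Cn n,
    dForm ω x u v = wedge (β x) (ω x) u v

/-- `c` is the variational index `Var(𝓕, V, Z)`, computed at the generic point `p` with the
generator `Γ`: `c = (1 / 2πi) ∫_Γ β` for a smooth (1,0)-form `β` on `B*` with `dω = β ∧ ω`. -/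
def IsVariationalIndex {n : ℕ} {U : Set (Cn n)} (ω : OneForm n) {f : Cn n → ℂ}
    {Z : Set (Cn n)} {p : Cn n} {r : ℝ} {S : TransverseSection U f Z p r}
    (Γ : PositiveGenerator S) (c : ℂ) : Prop :=
  ∃ β : OneForm n, IsGodbillonForm U ω f p r β ∧
    c = 1 / (2 * Real.pi * Complex.I) * Γ.integral β

/-- The meromorphic 1-form `(g / h) d(h / g) - η / h`. -/
def saitoForm {n : ℕ} (g h : Cn n → ℂ) (η : OneForm n) : OneForm n :=
  fun x => (g x / h x) • fderiv ℂ (fun y => h y / g y) x - (1 / h x) • η x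

end FoliationGerm

end

/-!
Differentiating `g ω = h df + f η` and restricting to `V = {f = 0}`, where `h df = g ω`, gives
`dω = (dh / h - dg / g - η / h) ∧ ω` wherever `g h ≠ 0`. The form in brackets is the logarithmic
form of the formula. Two solutions `β` of `dω = β ∧ ω` at a point with `ω ≠ 0` differ by a multiple
of `ω`, and `ω` vanishes on the tangent vectors of `V`, so all solutions have the same integral
along curves in `V`. A global smooth solution comes from contracting `ω ∧ dω = 0` with a vector
field `u` such that `ω(u) ≠ 0`; where `ω ≠ 0`, the Hermitian gradient of `ω` is one.
-/

section LevelSets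

variable {𝕜 E F G : Type*} [RCLike 𝕜] [NormedAddCommGroup E] [NormedSpace 𝕜 E] [NormedSpace ℝ E]
  [NormedAddCommGroup F] [NormedSpace 𝕜 F] [NormedAddCommGroup G] [NormedSpace 𝕜 G]

theorem fderiv_apply_derivWithin_eq_zero_of_const {f : E → F} {γ : ℝ → E} {s : Set ℝ} {t : ℝ}
    {c : F} (hf : DifferentiableAt 𝕜 f (γ t)) (hγ : DifferentiableWithinAt ℝ γ s t)
    (hs : UniqueDiffWithinAt ℝ s t) (ht : t ∈ s) (hc : ∀ τ ∈ s, f (γ τ) = c) :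
    fderiv 𝕜 f (γ t) (derivWithin γ s t) = 0 := by
  let _ : NormedSpace ℝ F := .restrictScalars ℝ 𝕜 F
  have hcomp : HasDerivWithinAt (f ∘ γ) (fderiv 𝕜 f (γ t) (derivWithin γ s t)) s t :=
    (hf.hasFDerivAt.restrictScalars ℝ).comp_hasDerivWithinAt t hγ.hasDerivWithinAt
  have hconst : HasDerivWithinAt (f ∘ γ) 0 s t :=
    (hasDerivWithinAt_const t s c).congr hc (hc t ht)
  exact hs.eq_deriv _ hcomp hconst

theorem curveIntegral_eq_of_eq_on_ker_fderiv {f : E → F} {α β : E → E →L[𝕜] G} {a b : E}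
    {γ : Path a b} {c : F} (hγ : ContDiffOn ℝ 1 γ.extend I)
    (hf : ∀ t, DifferentiableAt 𝕜 f (γ t)) (hc : ∀ t, f (γ t) = c)
    (hαβ : ∀ t v, fderiv 𝕜 f (γ t) v = 0 → α (γ t) v = β (γ t) v) :
    curveIntegral α γ = curveIntegral β γ := by
  let _ : NormedSpace ℝ G := .restrictScalars ℝ 𝕜 G
  rw [curveIntegral_def, curveIntegral_def]
  refine intervalIntegral.integral_congr fun t ht => ?_
  rw [uIcc_of_le zero_le_one] at ht
  have htangent : fderiv 𝕜 f (γ.extend t) (derivWithin γ.extend I t) = 0 := by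
    refine fderiv_apply_derivWithin_eq_zero_of_const (c := c) ?_
      (hγ.differentiableOn one_ne_zero t ht) (uniqueDiffOn_Icc_zero_one t ht) ht fun τ hτ => ?_
    · rw [γ.extend_apply ht]
      exact hf _
    · rw [γ.extend_apply hτ]
      exact hc _
  rw [γ.extend_apply ht] at htangent
  simpa only [curveIntegralFun_def, γ.extend_apply ht] using hαβ ⟨t, ht⟩ _ htangent

end LevelSets

theorem inv_smul_fderiv_div {𝕜 E : Type*} [NontriviallyNormedField 𝕜] [NormedAddCommGroup E]
    [NormedSpace 𝕜 E] {a b : E → 𝕜} {x : E} (ha : DifferentiableAt 𝕜 a x)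
    (hb : DifferentiableAt 𝕜 b x) (ha0 : a x ≠ 0) (hb0 : b x ≠ 0) :
    (a x / b x)⁻¹ • fderiv 𝕜 (fun y => a y / b y) x =
      (a x)⁻¹ • fderiv 𝕜 a x - (b x)⁻¹ • fderiv 𝕜 b x := by
  have hinv : HasFDerivAt (fun y => (b y)⁻¹) (-(b x ^ 2)⁻¹ • fderiv 𝕜 b x) x :=
    (hasDerivAt_inv hb0).comp_hasFDerivAt x hb.hasFDerivAt
  ext u
  simp only [div_eq_mul_inv, (ha.hasFDerivAt.fun_mul hinv).fderiv, add_apply, sub_apply,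
    smul_apply, smul_eq_mul]
  field_simp
  ring

section Smoothness

theorem contDiff_clm_flip {𝕜 E F G : Type*} [NontriviallyNormedField 𝕜]
    [NormedAddCommGroup E] [NormedSpace 𝕜 E] [NormedAddCommGroup F] [NormedSpace 𝕜 F]
    [NormedAddCommGroup G] [NormedSpace 𝕜 G] {m : WithTop ℕ∞} :
    ContDiff 𝕜 m (fun L : E →L[𝕜] F →L[𝕜] G => L.flip) :=
  LinearIsometryEquiv.contDiff (𝕜 := 𝕜) (E := E →L[𝕜] F →L[𝕜] G) (F := F →L[𝕜] E →L[𝕜] G)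
    (ContinuousLinearMap.flipₗᵢ 𝕜 E F G)

theorem contDiffAt_real_clm_apply {E F G : Type*} [NormedAddCommGroup E] [NormedSpace ℝ E]
    [NormedAddCommGroup F] [NormedSpace ℂ F] [NormedAddCommGroup G] [NormedSpace ℂ G]
    {L : E → F →L[ℂ] G} {v : E → F} {m : WithTop ℕ∞} {x : E}
    (hL : ContDiffAt ℝ m L x) (hv : ContDiffAt ℝ m v x) :
    ContDiffAt ℝ m (fun y => L y (v y)) x :=
  ((isBoundedBilinearMap_apply (𝕜 := ℂ) (E := F) (F := G)).contDiff.restrict_scalars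
    ℝ).contDiffAt.comp x (hL.prodMk hv)

theorem contDiff_real_toDual_symm {E : Type*} [NormedAddCommGroup E] [InnerProductSpace ℂ E]
    [CompleteSpace E] {m : WithTop ℕ∞} :
    ContDiff ℝ m (InnerProductSpace.toDual ℂ E).symm :=
  (AddMonoidHom.toRealLinearMap ((InnerProductSpace.toDual ℂ E).symm : StrongDual ℂ E →+ E)
    (InnerProductSpace.toDual ℂ E).symm.continuous).contDiff

end Smoothness

namespace FoliationGerm

variable {n : ℕ} {ω η : OneForm n} {f g h : Cn n → ℂ} {x : Cn n}

section ExteriorDerivative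

variable {α β : OneForm n}

theorem dForm_congr (hαβ : α =ᶠ[𝓝 x] β) (u v : Cn n) : dForm α x u v = dForm β x u v := by
  simp only [dForm, hαβ.fderiv_eq]

theorem dForm_add (hα : DifferentiableAt ℂ α x) (hβ : DifferentiableAt ℂ β x) (u v : Cn n) :
    dForm (fun y => α y + β y) x u v = dForm α x u v + dForm β x u v := by
  simp only [dForm, fderiv_fun_add hα hβ, add_apply]
  ring

theorem dForm_smul (hg : DifferentiableAt ℂ g x) (hα : DifferentiableAt ℂ α x) (u v : Cn n) :
    dForm (fun y => g y • α y) x u v =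
      wedge (fderiv ℂ g x) (α x) u v + g x * dForm α x u v := by
  simp only [dForm, wedge, fderiv_fun_smul hg hα, add_apply, smul_apply,
    ContinuousLinearMap.smulRight_apply, smul_eq_mul]
  ring

theorem dForm_fderiv (hf : ContDiffAt ℂ 2 f x) (u v : Cn n) : dForm (fderiv ℂ f) x u v = 0 :=
  sub_eq_zero.2 (hf.isSymmSndFDerivAt (by simp) u v)

end ExteriorDerivative

section SaitoForm

theorem saitoForm_eq (hg : DifferentiableAt ℂ g x) (hh : DifferentiableAt ℂ h x)
    (hg0 : g x ≠ 0) (hh0 : h x ≠ 0) :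
    saitoForm g h η x =
      (h x)⁻¹ • fderiv ℂ h x - (g x)⁻¹ • fderiv ℂ g x - (h x)⁻¹ • η x := by
  rw [saitoForm, ← inv_div, inv_smul_fderiv_div hh hg hh0 hg0, one_div]

theorem continuousAt_saitoForm (hg : ContDiffAt ℂ 1 g x) (hh : ContDiffAt ℂ 1 h x)
    (hη : ContinuousAt η x) (hg0 : g x ≠ 0) (hh0 : h x ≠ 0) :
    ContinuousAt (saitoForm g h η) x :=
  ((hg.continuousAt.div hh.continuousAt hh0).smul
    ((hh.div hg hg0).continuousAt_fderiv one_ne_zero)).sub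
    ((continuousAt_const.div hh.continuousAt hh0).smul hη)

theorem fderiv_eq_div_smul_of_eq_zero (heq : g x • ω x = h x • fderiv ℂ f x + f x • η x)
    (hf0 : f x = 0) (hh0 : h x ≠ 0) : fderiv ℂ f x = (g x / h x) • ω x := by
  have hη0 : f x • η x = 0 := by
    ext
    simp [hf0]
  rw [hη0, add_zero] at heq
  rw [div_eq_inv_mul, mul_smul, heq, inv_smul_smul₀ hh0]

theorem apply_eq_of_wedge_eq {α β θ : Cn n →L[ℂ] ℂ} (hθ : θ ≠ 0)
    (hαβ : ∀ u v, wedge α θ u v = wedge β θ u v) {v : Cn n} (hv : θ v = 0) : α v = β v := by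
  obtain ⟨u, hu⟩ : ∃ u, θ u ≠ 0 := DFunLike.ne_iff.1 hθ
  simpa [wedge, hv, hu] using hαβ u v

variable (hω : DifferentiableAt ℂ ω x) (hη : DifferentiableAt ℂ η x) (hf : ContDiffAt ℂ 2 f x)
  (hg : DifferentiableAt ℂ g x) (hh : DifferentiableAt ℂ h x)
  (heq : ∀ᶠ y in 𝓝 x, g y • ω y = h y • fderiv ℂ f y + f y • η y)

include hω hη hf hg hh heq

theorem wedge_fderiv_add_smul_dForm (u v : Cn n) :
    wedge (fderiv ℂ g x) (ω x) u v + g x * dForm ω x u v =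
      wedge (fderiv ℂ h x) (fderiv ℂ f x) u v +
        (wedge (fderiv ℂ f x) (η x) u v + f x * dForm η x u v) := by
  have hf' : DifferentiableAt ℂ f x := hf.differentiableAt two_ne_zero
  have hdf : DifferentiableAt ℂ (fderiv ℂ f) x :=
    (hf.fderiv_right (m := 1) le_rfl).differentiableAt one_ne_zero
  rw [← dForm_smul hg hω, dForm_congr heq, dForm_add (hh.fun_smul hdf) (hf'.fun_smul hη),
    dForm_smul hh hdf, dForm_fderiv hf, mul_zero, add_zero, dForm_smul hf' hη]

theorem dForm_eq_wedge_saitoForm (hf0 : f x = 0) (hg0 : g x ≠ 0) (hh0 : h x ≠ 0) (u v : Cn n) :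
    dForm ω x u v = wedge (saitoForm g h η x) (ω x) u v := by
  have hdf := fderiv_eq_div_smul_of_eq_zero heq.self_of_nhds hf0 hh0
  have hd := wedge_fderiv_add_smul_dForm hω hη hf hg hh heq u v
  rw [hf0, hdf] at hd
  rw [saitoForm_eq hg hh hg0 hh0]
  simp only [wedge, sub_apply, smul_apply, smul_eq_mul] at hd ⊢
  field_simp at hd ⊢
  linear_combination hd

theorem apply_eq_saitoForm_apply (hf0 : f x = 0) (hg0 : g x ≠ 0) (hh0 : h x ≠ 0)
    (hω0 : ω x ≠ 0) {β : Cn n →L[ℂ] ℂ} (hβ : ∀ u v, dForm ω x u v = wedge β (ω x) u v)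
    {v : Cn n} (hv : fderiv ℂ f x v = 0) : β v = saitoForm g h η x v := by
  have hωv : ω x v = 0 := by
    simpa [fderiv_eq_div_smul_of_eq_zero heq.self_of_nhds hf0 hh0, hg0, hh0] using hv
  refine apply_eq_of_wedge_eq hω0 (fun u w => ?_) hωv
  rw [← hβ, dForm_eq_wedge_saitoForm hω hη hf hg hh heq hf0 hg0 hh0]

end SaitoForm

section GodbillonForm

/-- The exterior derivative `dω` at `x` as a bilinear form, so that `dFormCLM ω x u` is the
contraction of `dω` with `u`. -/
noncomputable def dFormCLM (ω : OneForm n) (x : Cn n) : Cn n →L[ℂ] Cn n →L[ℂ] ℂ :=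
  fderiv ℂ ω x - (fderiv ℂ ω x).flip

theorem dFormCLM_apply (ω : OneForm n) (x u v : Cn n) : dFormCLM ω x u v = dForm ω x u v := rfl

/-- The vector field dual to `ω` under the Hermitian inner product. It depends only
real-smoothly on the point, because Riesz duality is conjugate-linear. -/
noncomputable def hermitianGradient (ω : OneForm n) (x : Cn n) : Cn n :=
  (InnerProductSpace.toDual ℂ (Cn n)).symm (ω x)

/-- The solution `β = -i_u dω / ω(u)` of `dω = β ∧ ω`, where `u` is the Hermitian gradient of `ω`.
At the zeros of `ω` it has the junk value `0`. -/
noncomputable def godbillonForm (ω : OneForm n) : OneForm n := fun x =>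
  -(ω x (hermitianGradient ω x))⁻¹ • dFormCLM ω x (hermitianGradient ω x)

theorem apply_hermitianGradient_ne_zero (hx : ω x ≠ 0) : ω x (hermitianGradient ω x) ≠ 0 := by
  rw [hermitianGradient, ← InnerProductSpace.toDual_symm_apply, inner_self_ne_zero]
  simpa using hx

theorem dForm_eq_wedge_of_apply_ne_zero
    (hint : ∀ u v w : Cn n,
      ω x u * dForm ω x v w - ω x v * dForm ω x u w + ω x w * dForm ω x u v = 0)
    {u : Cn n} (hu : ω x u ≠ 0) (v w : Cn n) :
    dForm ω x v w = wedge (-(ω x u)⁻¹ • dFormCLM ω x u) (ω x) v w := by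
  simp only [wedge, smul_apply, dFormCLM_apply, smul_eq_mul]
  field_simp
  linear_combination hint u v w

theorem contDiffAt_hermitianGradient {m : WithTop ℕ∞} (hω : ContDiffAt ℝ m ω x) :
    ContDiffAt ℝ m (hermitianGradient ω) x :=
  contDiff_real_toDual_symm.contDiffAt.comp x hω

theorem contDiffAt_dFormCLM {m : WithTop ℕ∞} (hω : ContDiffAt ℂ (m + 1) ω x) :
    ContDiffAt ℂ m (dFormCLM ω) x :=
  have hdω : ContDiffAt ℂ m (fderiv ℂ ω) x := hω.fderiv_right le_rfl
  hdω.sub (contDiff_clm_flip.contDiffAt.comp x hdω)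

theorem contDiffAt_godbillonForm {m : WithTop ℕ∞} (hω : ContDiffAt ℂ (m + 1) ω x)
    (hx : ω x ≠ 0) : ContDiffAt ℝ m (godbillonForm ω) x := by
  have hωm : ContDiffAt ℝ m ω x := (hω.of_le le_self_add).restrict_scalars ℝ
  have hdω : ContDiffAt ℝ m (dFormCLM ω) x := (contDiffAt_dFormCLM hω).restrict_scalars ℝ
  have hu : ContDiffAt ℝ m (hermitianGradient ω) x := contDiffAt_hermitianGradient hωm
  exact ((contDiffAt_real_clm_apply hωm hu).inv (apply_hermitianGradient_ne_zero hx)).neg.smul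
    (contDiffAt_real_clm_apply hdω hu)

end GodbillonForm

variable {U : Set (Cn n)} {Z : Set (Cn n)} {p : Cn n} {r : ℝ}

theorem isGodbillonForm_godbillonForm (hω : ∀ y ∈ Metric.ball p r, AnalyticAt ℂ ω y)
    (hint : ∀ y ∈ Metric.ball p r, ∀ u v w : Cn n,
      ω y u * dForm ω y v w - ω y v * dForm ω y u w + ω y w * dForm ω y u v = 0)
    (hreg : ∀ y ∈ Metric.ball p r \ sing₂V U ω f, ω y ≠ 0) :
    IsGodbillonForm U ω f p r (godbillonForm ω) where
  smooth y hy :=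
    (contDiffAt_godbillonForm (hω y hy.1).contDiffAt (hreg y hy)).contDiffWithinAt
  eq y hy := dForm_eq_wedge_of_apply_ne_zero (hint y hy.1)
    (apply_hermitianGradient_ne_zero (hreg y hy))

namespace IsGenericBall

theorem notMem_sing₂V (hp : IsGenericBall U ω f Z p r) (hx : x ∈ Metric.ball p r) (hxZ : x ∉ Z) :
    x ∉ sing₂V U ω f :=
  fun hs => hxZ (hp.sing₂V_eq.subset ⟨hs, hx⟩).1

theorem ne_zero (hp : IsGenericBall U ω f Z p r) (hx : x ∈ Metric.ball p r \ sing₂V U ω f) :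
    ω x ≠ 0 := fun h0 =>
  have hxZ : x ∈ Z := hp.sing_subset ⟨⟨hp.subset hx.1, h0⟩, hx.1⟩
  hx.2 (hp.sing₂V_eq.superset ⟨hxZ, hx.1⟩).1

end IsGenericBall

namespace PositiveGenerator

variable {S : TransverseSection U f Z p r}

theorem curve_mem (Γ : PositiveGenerator S) (i : Fin S.m) (t : I) :
    Γ.curve i t ∈ hyp U f ∩ Metric.ball p r :=
  S.mem i _ (Γ.mem i t)

theorem curve_notMem (Γ : PositiveGenerator S) (i : Fin S.m) (t : I) : Γ.curve i t ∉ Z :=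
  S.notMem i _ (Γ.mem i t) (Γ.ne_zero i t)

theorem contDiffOn_curve (Γ : PositiveGenerator S) (i : Fin S.m) :
    ContDiffOn ℝ 1 (Γ.curve i).extend I := by
  have hφ : ContDiffOn ℝ 1 (S.φ i) (Metric.closedBall 0 1) := fun s hs =>
    ((S.analytic i s hs).contDiffAt.restrict_scalars ℝ).contDiffWithinAt
  refine (hφ.comp (Γ.smooth i) fun t ht => ?_).congr fun t ht => ?_
  · rw [Path.extend_apply _ ht]
    exact Γ.mem i _
  · rw [Path.extend_apply _ ht, Function.comp_apply, Path.extend_apply _ ht]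
    rfl

theorem curveIntegrable_saitoForm (Γ : PositiveGenerator S) (i : Fin S.m)
    (hg : AnalyticOnNhd ℂ g (Metric.ball p r)) (hh : AnalyticOnNhd ℂ h (Metric.ball p r))
    (hη : ContinuousOn η (Metric.ball p r))
    (hΓ : ∀ t, g (Γ.curve i t) ≠ 0 ∧ h (Γ.curve i t) ≠ 0) :
    CurveIntegrable (saitoForm g h η) (Γ.curve i) := by
  have hcont : ContinuousOn (saitoForm g h η) (range (Γ.curve i)) := by
    rintro _ ⟨t, rfl⟩
    have hB := (Γ.curve_mem i t).2
    exact (continuousAt_saitoForm (hg _ hB).contDiffAt (hh _ hB).contDiffAt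
      (hη.continuousAt (Metric.isOpen_ball.mem_nhds hB)) (hΓ t).1 (hΓ t).2).continuousWithinAt
  exact hcont.curveIntegrable_of_contDiffOn (Γ.contDiffOn_curve i) mem_range_self

theorem integral_eq_integral_saitoForm (Γ : PositiveGenerator S) (hp : IsGenericBall U ω f Z p r)
    (hω : AnalyticOnNhd ℂ ω U) (hf : AnalyticOnNhd ℂ f U) (hg : AnalyticOnNhd ℂ g U)
    (hh : AnalyticOnNhd ℂ h U) (hη : AnalyticOnNhd ℂ η U)
    (heq : ∀ y ∈ U, g y • ω y = h y • fderiv ℂ f y + f y • η y)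
    (hΓ : ∀ i t, g (Γ.curve i t) ≠ 0 ∧ h (Γ.curve i t) ≠ 0) {β : OneForm n}
    (hβ : IsGodbillonForm U ω f p r β) :
    Γ.integral β = Γ.integral (saitoForm g h η) := by
  refine Finset.sum_congr rfl fun i _ => curveIntegral_eq_of_eq_on_ker_fderiv
    (Γ.contDiffOn_curve i) (fun t => (hf _ (Γ.curve_mem i t).1.1).differentiableAt)
    (fun t => (Γ.curve_mem i t).1.2) fun t v hv => ?_
  obtain ⟨⟨hxU, hf0⟩, hxB⟩ := Γ.curve_mem i t
  obtain ⟨hg0, hh0⟩ := hΓ i t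
  have hx : Γ.curve i t ∈ Metric.ball p r \ sing₂V U ω f :=
    ⟨hxB, hp.notMem_sing₂V hxB (Γ.curve_notMem i t)⟩
  have heq_near : ∀ᶠ y in 𝓝 (Γ.curve i t), g y • ω y = h y • fderiv ℂ f y + f y • η y :=
    eventually_of_mem (Metric.isOpen_ball.mem_nhds hxB) fun y hy => heq y (hp.subset hy)
  exact apply_eq_saitoForm_apply (hω _ hxU).differentiableAt (hη _ hxU).differentiableAt
    (hf _ hxU).contDiffAt (hg _ hxU).differentiableAt (hh _ hxU).differentiableAt heq_near
    hf0 hg0 hh0 (hp.ne_zero hx) (hβ.eq _ hx) hv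

end PositiveGenerator

end FoliationGerm

open FoliationGerm in
theorem mainTheorem7_general {n : ℕ} {U : Set (Cn n)} {ω η : OneForm n} {f g h : Cn n → ℂ}
    (hω : AnalyticOnNhd ℂ ω U)
    (hint : ∀ x ∈ U, ∀ u v w : Cn n,
      ω x u * dForm ω x v w - ω x v * dForm ω x u w + ω x w * dForm ω x u v = 0)
    (hf : AnalyticOnNhd ℂ f U) (hg : AnalyticOnNhd ℂ g U) (hh : AnalyticOnNhd ℂ h U)
    (hη : AnalyticOnNhd ℂ η U)
    (heq : ∀ x ∈ U, g x • ω x = h x • fderiv ℂ f x + f x • η x)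
    {Z : Set (Cn n)} {p : Cn n} {r : ℝ} (hp : IsGenericBall U ω f Z p r)
    {S : TransverseSection U f Z p r} (Γ : PositiveGenerator S)
    (hΓ : ∀ i t, g (Γ.curve i t) ≠ 0 ∧ h (Γ.curve i t) ≠ 0) :
    (∀ i, CurveIntegrable (saitoForm g h η) (Γ.curve i)) ∧
    ∀ c : ℂ, IsVariationalIndex ω Γ c ↔
      c = 1 / (2 * Real.pi * Complex.I) * Γ.integral (saitoForm g h η) := by
  have hindep {β : OneForm n} (hβ : IsGodbillonForm U ω f p r β) :
      Γ.integral β = Γ.integral (saitoForm g h η) :=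
    Γ.integral_eq_integral_saitoForm hp hω hf hg hh hη heq hΓ hβ
  have hexists : IsGodbillonForm U ω f p r (godbillonForm ω) :=
    isGodbillonForm_godbillonForm (hω.mono hp.subset) (fun x hx => hint x (hp.subset hx))
      fun _ hx => hp.ne_zero hx
  refine ⟨fun i => Γ.curveIntegrable_saitoForm i (hg.mono hp.subset) (hh.mono hp.subset)
    (hη.continuousOn.mono hp.subset) (hΓ i), fun c => ⟨?_, ?_⟩⟩
  · rintro ⟨β, hβ, rfl⟩
    rw [hindep hβ]
  · rintro rfl
    exact ⟨_, hexists, by rw [hindep hexists]⟩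

theorem mainTheorem7 {n : ℕ} (hn : 2 ≤ n)
    (U : Set (FoliationGerm.Cn n)) (hU : IsOpen U) (h0 : 0 ∈ U)
    (ω : FoliationGerm.OneForm n) (hω : FoliationGerm.IsFoliation U ω)
    (f : FoliationGerm.Cn n → ℂ) (hf : AnalyticOnNhd ℂ f U)
    (hred : Squarefree (FoliationGerm.germOf f (hf 0 h0)))
    (hinv : FoliationGerm.IsInvariant U ω f)
    (Z : Set (FoliationGerm.Cn n))
    (hZ : FoliationGerm.IsIrreducibleComponent Z (FoliationGerm.sing₂V U ω f))
    (hZ2 : FoliationGerm.HasCodim 2 Z)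
    (g h : FoliationGerm.Cn n → ℂ) (η : FoliationGerm.OneForm n)
    (hS : FoliationGerm.IsSaitoDecomposition U ω f g h η)
    (p : FoliationGerm.Cn n) (r : ℝ) (hp : FoliationGerm.IsGenericBall U ω f Z p r)
    (S : FoliationGerm.TransverseSection U f Z p r)
    (Γ : FoliationGerm.PositiveGenerator S)
    (hΓ : ∀ i t, g (Γ.curve i t) ≠ 0 ∧ h (Γ.curve i t) ≠ 0) :
    (∀ i, CurveIntegrable (FoliationGerm.saitoForm g h η) (Γ.curve i)) ∧
    ∀ c : ℂ, FoliationGerm.IsVariationalIndex ω Γ c ↔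
      c = 1 / (2 * Real.pi * Complex.I) * Γ.integral (FoliationGerm.saitoForm g h η) :=
  mainTheorem7_general hω.holomorphic hω.integrable hf hS.g_hol hS.h_hol hS.η_hol hS.eq hp Γ hΓ
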